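/- Let $R$ be an associative ring with unity. The following are equivalent: (1) $R$ is left perfect and a right $H$-ring; (2) every simple-direct-injective right $R$-module is simple-direct-projective. Here all modules are unitary, and: a right $R$-module $M$ is simple-direct-injective if every simple submodule of $M$ that is isomorphic to a direct summand of $M$ is itself a direct summand of $M$; $M$ is simple-direct-projective if, whenever $A$ and $B$ are submodules of $M$ such that $B$ is simple, $B$ is a direct summand of $M$ and $M/A\cong B$, then $A$ is a direct summand of $M$; $R$ is left perfect if $R/J(R)$ is semisimple Artinian and the Jacobson radical $J(R)$ is left $T$-nilpotent, i.e. for every sequence $a_1,a_2,\dots$ in $J(R)$ there is an $n$ with $a_1a_2\cdots a_n=0$; $R$ is a right $H$-ring if $\operatorname{Hom}_R(E(S_1),E(S_2))=0$ for all non-isomorphic simple right $R$-modules $S_1,S_2$, where $E(S)$ denotes the injective hull of $S$. -/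

import Mathlib

universe u v w

/-- A (left) `R`-module `M` is simple-direct-injective if every simple submodule `A` of `M` that is
isomorphic to a direct summand `B` of `M` is itself a direct summand of `M`. Direct summands are the
submodules that have a complement in the lattice of submodules. Right `R`-modules are modules
over `Rᵐᵒᵖ`. -/
def IsSimpleDirectInjective (R : Type u) [Ring R] (M : Type v) [AddCommGroup M] [Module R M] :
    Prop :=
  ∀ A B : Submodule R M, IsSimpleModule R A → Nonempty (A ≃ₗ[R] B) → IsComplemented B →
    IsComplemented A

/-- A (left) `R`-module `M` is simple-direct-projective if, whenever `A` and `B` are submodules of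
`M` with `B` simple and `M ⧸ A ≅ B`, `B` a direct summand of `M`, then `A` is a direct summand
of `M`. -/
def IsSimpleDirectProjective (R : Type u) [Ring R] (M : Type v) [AddCommGroup M] [Module R M] :
    Prop :=
  ∀ A B : Submodule R M, IsSimpleModule R B → Nonempty ((M ⧸ A) ≃ₗ[R] B) → IsComplemented B →
    IsComplemented A

/-- A submodule `N` of `M` is essential if it meets every nonzero submodule nontrivially. -/
def Submodule.IsEssentialIn {R : Type u} [Ring R] {M : Type v} [AddCommGroup M] [Module R M]
    (N : Submodule R M) : Prop :=
  ∀ L : Submodule R M, N ⊓ L = ⊥ → L = ⊥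

/-- `i : M → E` is an injective hull of `M`: `E` is an injective module and `i` is a monomorphism
with essential image. -/
structure IsInjectiveHull {R : Type u} [Ring R] {M : Type v} {E : Type w} [AddCommGroup M]
    [Module R M] [AddCommGroup E] [Module R E] (i : M →ₗ[R] E) : Prop where
  injective_module : Module.Injective R E
  injective : Function.Injective i
  essential : (LinearMap.range i).IsEssentialIn

/-- `R` is a right H-ring: `Hom(E(S₁), E(S₂)) = 0` for all nonisomorphic simple right `R`-modules
`S₁` and `S₂`. As injective hulls are unique up to isomorphism, `E(S₁)` and `E(S₂)` range over all
injective hulls. -/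
def IsRightHRing (R : Type u) [Ring R] : Prop :=
  ∀ (S₁ S₂ E₁ E₂ : Type u) [AddCommGroup S₁] [AddCommGroup S₂] [AddCommGroup E₁] [AddCommGroup E₂]
    [Module Rᵐᵒᵖ S₁] [Module Rᵐᵒᵖ S₂] [Module Rᵐᵒᵖ E₁] [Module Rᵐᵒᵖ E₂]
    (i₁ : S₁ →ₗ[Rᵐᵒᵖ] E₁) (i₂ : S₂ →ₗ[Rᵐᵒᵖ] E₂),
    IsSimpleModule Rᵐᵒᵖ S₁ → IsSimpleModule Rᵐᵒᵖ S₂ → ¬ Nonempty (S₁ ≃ₗ[Rᵐᵒᵖ] S₂) →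
    IsInjectiveHull i₁ → IsInjectiveHull i₂ → ∀ f : E₁ →ₗ[Rᵐᵒᵖ] E₂, f = 0

/-- A subset `A` of a ring is left T-nilpotent if every sequence `a₀, a₁, …` in `A` has
`a₀ a₁ ⋯ aₙ₋₁ = 0` for some `n`. -/
def IsLeftTNilpotent {R : Type u} [Ring R] (A : Set R) : Prop :=
  ∀ a : ℕ → R, (∀ k, a k ∈ A) → ∃ n : ℕ, ((List.range n).map a).prod = 0

/-- `R` is left perfect: `R / J(R)` is semisimple Artinian and `J(R)` is left T-nilpotent. -/
structure IsLeftPerfectRing (R : Type u) [Ring R] : Prop where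
  isSemisimpleRing : IsSemisimpleRing (R ⧸ Ring.jacobson R)
  isLeftTNilpotent : IsLeftTNilpotent (Ring.jacobson R : Set R)

/-!
Write `P = Rᵐᵒᵖ`, so that right `R`-modules are `P`-modules.

*Left perfect right H-rings satisfy the implication.* Left T-nilpotence of `J(R)` makes every nonzero
element `x` of a right module have a nonzero multiple annihilated by `J`; as `P / J(P)` is
semisimple, `Px` then contains a simple submodule
(`exists_simple_submodule_le_span_singleton`). Given a simple module `B`, split the projection
`P / J(P) → B` and lift the resulting idempotent to `e ∈ P`
(`exists_isIdempotentElem_smul_eq`). By the H-condition `e` annihilates `E(T)` for each simple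
`T ≇ B`, since otherwise a cyclic submodule of `E(T)` would map onto `B`, hence `E(T)` nontrivially
to `E(B)` (`smul_injectiveHull_eq_zero`). Now let `M` be simple-direct-injective with `M / A ≅ B`,
where `B` is a summand of `M`. Some `y = e x` lies outside `A`. If `J y = 0`, then `P y` is simple
and complements `A`. Otherwise some `j y ≠ 0` with `j ∈ J` generates a submodule containing a simple
`T`; if `T ≅ B`, then `T` is a summand of `M` contained in `J M`, which is absurd, and if `T ≇ B`,
then the inclusion `T → E(T)` extends to `M` and the extension kills `y = e y`, hence `T`, which is
absurd as well.

*Conversely*, if `M` is simple-direct-injective, `S` is simple and `S` does not embed in `M`, then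
`M × S` is simple-direct-injective (`IsSimpleDirectInjective.prod`), and it is not
simple-direct-projective as soon as `S` is a quotient of `M`. Hence every simple quotient of a
simple-direct-injective module embeds in that module (`IsSimpleDirectInjective.exists_hom_ne_zero`).
This is applied to three kinds of modules.
* Cyclic modules without simple submodules: they are therefore zero, so all nonzero modules have
  simple submodules, which forces T-nilpotence.
* `P / J(P)`, all of whose simple submodules are summands: a simple quotient by a maximal submodule
  above the socle would be a summand, hence projective over `P / J(P)`, hence lift to the socle. So
  the socle is everything.
* The preimage of `S₂` under a nonzero map `E(S₁) → E(S₂)`, which has a unique simple submodule `S₁`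
  and has `S₂` as a quotient.
-/

open MulOpposite

/-! ### Simple submodules, direct summands and the Jacobson radical -/

section Modules

variable {P : Type u} [Ring P] {M : Type v} [AddCommGroup M] [Module P M]

/-- By Schur's lemma the restriction of `f` to `A` is an isomorphism, so `ker f` complements `A`. -/
theorem Submodule.isComplemented_of_simple_map_ne_zero {S : Type w} [AddCommGroup S] [Module P S]
    [IsSimpleModule P S] {A : Submodule P M} [IsSimpleModule P A] (f : M →ₗ[P] S) {a : M}
    (ha : a ∈ A) (hfa : f a ≠ 0) : IsComplemented A := by
  have hne : f ∘ₗ A.subtype ≠ 0 := fun h ↦ hfa (LinearMap.congr_fun h ⟨a, ha⟩)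
  let e := LinearEquiv.ofBijective _ (LinearMap.bijective_of_ne_zero hne)
  refine ⟨_, LinearMap.isCompl_of_proj (f := e.symm.toLinearMap ∘ₗ f) fun x ↦ ?_⟩
  exact e.symm_apply_apply x

theorem Submodule.exists_projection_of_isComplemented {A : Submodule P M} (hA : IsComplemented A) :
    ∃ f : M →ₗ[P] A, ∀ a : A, f a = a :=
  let ⟨_, h⟩ := hA
  ⟨A.projectionOnto _ h, Submodule.projectionOnto_apply_left h⟩

theorem Submodule.isCompl_of_isCoatom_of_not_le {A T : Submodule P M} [IsSimpleModule P T]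
    (hA : IsCoatom A) (hT : ¬ T ≤ A) : IsCompl A T := by
  have hT' : IsAtom T := isSimpleModule_iff_isAtom.1 inferInstance
  exact ⟨(hT'.not_le_iff_disjoint.1 hT).symm, codisjoint_iff.2 (hA.2 _ (left_lt_sup.2 hT))⟩

theorem jacobson_smul_eq_zero_of_isSimpleModule [IsSimpleModule P M] {j : P}
    (hj : j ∈ Ring.jacobson P) (x : M) : j • x = 0 := by
  have h := Ring.jacobson_smul_top_le P M (Submodule.smul_mem_smul hj (Submodule.mem_top (x := x)))
  rwa [IsSimpleModule.jacobson_eq_bot, Submodule.mem_bot] at h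

theorem jacobson_smul_eq_zero_quotient {j : P} (hj : j ∈ Ring.jacobson P)
    (x : P ⧸ Ring.jacobson P) : j • x = 0 := by
  obtain ⟨r, rfl⟩ := Submodule.Quotient.mk_surjective _ x
  rw [← Submodule.Quotient.mk_smul, Submodule.Quotient.mk_eq_zero]
  exact Ideal.mul_mem_right r _ hj

/-- The map `P ⧸ J(P) → M` sending `1` to an element of `M` that `J(P)` annihilates. -/
def jacobsonQuotientToModule (y : M) (hy : ∀ j ∈ Ring.jacobson P, j • y = 0) :
    (P ⧸ Ring.jacobson P) →ₗ[P] M :=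
  (Ring.jacobson P).liftQ (LinearMap.toSpanSingleton P M y) hy

@[simp]
theorem jacobsonQuotientToModule_mk (y : M) (hy : ∀ j ∈ Ring.jacobson P, j • y = 0) (r : P) :
    jacobsonQuotientToModule y hy (Submodule.Quotient.mk r) = r • y := rfl

theorem isSimpleModule_range {S : Type w} [AddCommGroup S] [Module P S] [IsSimpleModule P S]
    {g : S →ₗ[P] M} (hg : g ≠ 0) : IsSimpleModule P (LinearMap.range g) :=
  .congr (LinearEquiv.ofInjective g (LinearMap.injective_of_ne_zero hg)).symm

end Modules

/-! ### Modules over a ring whose simple-direct-injective modules are simple-direct-projective -/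

section SimpleDirect

variable {P : Type u} [Ring P]

/-- The hypothesis on `S` forces each simple submodule of `M × S` either to be `0 × S` or to lie
in `M × 0`. -/
theorem IsSimpleDirectInjective.prod {M : Type v} {S : Type w} [AddCommGroup M] [Module P M]
    [AddCommGroup S] [Module P S] [IsSimpleModule P S] (hM : IsSimpleDirectInjective P M)
    (hS : ∀ g : S →ₗ[P] M, g = 0) : IsSimpleDirectInjective P (M × S) := by
  rintro A B hA ⟨e⟩ hB
  have hB' : IsSimpleModule P B := .congr e.symm
  -- a simple `C` with nonzero first projection lies in `M × 0`: otherwise `S ≅ C` embeds in `M`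
  have key : ∀ C : Submodule P (M × S), IsSimpleModule P C → (∃ c ∈ C, c.1 ≠ 0) →
      ∀ c ∈ C, c.2 = 0 := by
    rintro C hC ⟨c, hc, hc1⟩ d hd
    by_contra hd2
    have h2 : LinearMap.snd P M S ∘ₗ C.subtype ≠ 0 :=
      fun h ↦ hd2 (LinearMap.congr_fun h ⟨d, hd⟩)
    let e2 := LinearEquiv.ofBijective _ (LinearMap.bijective_of_ne_zero h2)
    have := LinearMap.congr_fun (hS (LinearMap.fst P M S ∘ₗ C.subtype ∘ₗ e2.symm.toLinearMap))
      (e2 ⟨c, hc⟩)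
    simp at this
    exact hc1 this
  by_cases h1 : ∃ a ∈ A, a.1 ≠ 0
  · have hA2 := key A hA h1
    obtain ⟨a, ha, ha1⟩ := h1
    -- `B` also lies in `M × 0`: otherwise `S ≅ B ≅ A` would embed in `M`.
    have hB2 : ∀ b ∈ B, b.2 = 0 := by
      intro b hb
      by_contra hb2
      have h2 : LinearMap.snd P M S ∘ₗ B.subtype ≠ 0 :=
        fun h ↦ hb2 (LinearMap.congr_fun h ⟨b, hb⟩)
      let e2 := LinearEquiv.ofBijective _ (LinearMap.bijective_of_ne_zero h2)
      have := LinearMap.congr_fun (hS (LinearMap.fst P M S ∘ₗ A.subtype ∘ₗ e.symm.toLinearMap ∘ₗ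
        e2.symm.toLinearMap)) (e2 (e ⟨a, ha⟩))
      simp at this
      exact ha1 this
    have iso : ∀ C : Submodule P (M × S), (∀ c ∈ C, c.2 = 0) →
        Nonempty (C ≃ₗ[P] C.comap (LinearMap.inl P M S)) := fun C hC ↦
      ⟨LinearEquiv.ofBijective ((LinearMap.fst P M S ∘ₗ C.subtype).codRestrict _ fun c ↦ by
          have : ((c : M × S).1, (0 : S)) = c := Prod.ext rfl (hC c c.2).symm
          simp [this]) ⟨
        fun c d h ↦ Subtype.ext (Prod.ext (congrArg Subtype.val h)
          ((hC c c.2).trans (hC d d.2).symm)),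
        fun m ↦ ⟨⟨_, m.2⟩, rfl⟩⟩⟩
    obtain ⟨eA⟩ := iso A hA2
    obtain ⟨eB⟩ := iso B hB2
    have hA' : IsSimpleModule P (A.comap (LinearMap.inl P M S)) := .congr eA.symm
    have hBc : IsComplemented (B.comap (LinearMap.inl P M S)) := by
      have : IsSimpleModule P (B.comap (LinearMap.inl P M S)) := .congr eB.symm
      obtain ⟨f, hf⟩ := Submodule.exists_projection_of_isComplemented hB
      have := IsSimpleModule.nontrivial P B
      obtain ⟨b, hb⟩ := exists_ne (0 : B)
      have hbb : LinearMap.inl P M S (b : M × S).1 = b := Prod.ext rfl (hB2 b b.2).symm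
      refine Submodule.isComplemented_of_simple_map_ne_zero (f ∘ₗ LinearMap.inl P M S)
        (a := (b : M × S).1) (by rw [Submodule.mem_comap, hbb]; exact b.2) ?_
      rw [LinearMap.comp_apply, hbb, hf]
      exact hb
    obtain ⟨f, hf⟩ := Submodule.exists_projection_of_isComplemented
      (hM _ _ hA' ⟨eA.symm ≪≫ₗ e ≪≫ₗ eB⟩ hBc)
    refine Submodule.isComplemented_of_simple_map_ne_zero (f ∘ₗ LinearMap.fst P M S) ha ?_
    have haa : (a.1, (0 : S)) = a := Prod.ext rfl (hA2 a ha).symm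
    rw [LinearMap.comp_apply, LinearMap.fst_apply,
      hf ⟨a.1, by rw [Submodule.mem_comap, LinearMap.inl_apply, haa]; exact ha⟩]
    exact fun h ↦ ha1 (congrArg Subtype.val h)
  · push Not at h1
    have := IsSimpleModule.nontrivial P A
    obtain ⟨a, ha⟩ := exists_ne (0 : A)
    refine Submodule.isComplemented_of_simple_map_ne_zero (LinearMap.snd P M S) a.2 fun h ↦ ?_
    exact ha (Subtype.ext (Prod.ext (h1 a a.2) h))

/-- Over a ring whose simple-direct-injective modules are simple-direct-projective, every simple
quotient `S` of a simple-direct-injective module `M` embeds in `M`. Otherwise `M × S` would be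
simple-direct-injective, and a complement of the kernel of `M × S → M → S` would be a copy of `S`
contained in `0 × S`, thus in that kernel. -/
theorem IsSimpleDirectInjective.exists_hom_ne_zero {M S : Type u} [AddCommGroup M] [Module P M]
    [AddCommGroup S] [Module P S] [IsSimpleModule P S] (hM : IsSimpleDirectInjective P M)
    (h : ∀ (M : Type u) [AddCommGroup M] [Module P M],
      IsSimpleDirectInjective P M → IsSimpleDirectProjective P M)
    {f : M →ₗ[P] S} (hf : f ≠ 0) :
    ∃ g : S →ₗ[P] M, g ≠ 0 := by
  by_contra! hS
  let F : M × S →ₗ[P] S := f ∘ₗ LinearMap.fst P M S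
  have hF : Function.Surjective F :=
    (LinearMap.surjective_of_ne_zero hf).comp LinearMap.fst_surjective
  let i := LinearEquiv.ofInjective (LinearMap.inr P M S) LinearMap.inr_injective
  obtain ⟨C, hC⟩ := h _ (hM.prod hS) (LinearMap.ker F) (LinearMap.range (LinearMap.inr P M S))
    (.congr i.symm) ⟨F.quotKerEquivOfSurjective hF ≪≫ₗ i⟩ ⟨_, LinearMap.isCompl_range_inl_inr.symm⟩
  let e : S ≃ₗ[P] C :=
    (F.quotKerEquivOfSurjective hF).symm ≪≫ₗ Submodule.quotientEquivOfIsCompl _ C hC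
  have := IsSimpleModule.nontrivial P S
  obtain ⟨s, hs⟩ := exists_ne (0 : S)
  have h1 : (e s : M × S).1 = 0 :=
    LinearMap.congr_fun (hS (LinearMap.fst P M S ∘ₗ C.subtype ∘ₗ e.toLinearMap)) s
  have h2 : (e s : M × S) ∈ LinearMap.ker F := by simp [F, h1]
  have h3 := Submodule.disjoint_def.1 hC.disjoint _ h2 (e s).2
  exact hs (by simpa using h3)

variable (h : ∀ (M : Type u) [AddCommGroup M] [Module P M],
      IsSimpleDirectInjective P M → IsSimpleDirectProjective P M)
include h

theorem exists_simple_submodule_of_nontrivial (M : Type u) [AddCommGroup M] [Module P M]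
    [Nontrivial M] : ∃ T : Submodule P M, IsSimpleModule P T := by
  by_contra! hM
  obtain ⟨x, hx⟩ := exists_ne (0 : M)
  let N := Submodule.span P {x}
  have : Nontrivial N := ⟨⟨x, Submodule.mem_span_singleton_self x⟩, 0, by simpa [N] using hx⟩
  have : Module.Finite P N := Module.Finite.span_singleton P x
  obtain ⟨K, hK, -⟩ := (eq_top_or_exists_le_coatom (⊥ : Submodule P N)).resolve_left bot_ne_top
  have : IsSimpleModule P (N ⧸ K) := isSimpleModule_iff_isCoatom.2 hK
  have hno : ∀ T : Submodule P N, ¬ IsSimpleModule P T := fun T hT ↦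
    hM _ (.congr (T.equivMapOfInjective _ N.subtype_injective).symm)
  obtain ⟨g, hg⟩ := IsSimpleDirectInjective.exists_hom_ne_zero
    (fun A _ hA ↦ (hno A hA).elim) h (f := K.mkQ) (fun h0 ↦ hK.1 (by rw [← K.ker_mkQ, h0]; simp))
  exact hno _ (isSimpleModule_range hg)

theorem isSemisimpleModule_quotient_jacobson : IsSemisimpleModule P (P ⧸ Ring.jacobson P) := by
  have hcomp : ∀ A : Submodule P (P ⧸ Ring.jacobson P), IsSimpleModule P A → IsComplemented A := by
    intro A hA
    by_contra hc
    have hle : A ≤ Module.jacobson P (P ⧸ Ring.jacobson P) := le_sInf fun K hK ↦ by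
      by_contra hAK
      exact hc ⟨K, (Submodule.isCompl_of_isCoatom_of_not_le hK hAK).symm⟩
    rw [Module.jacobson_quotient_jacobson, le_bot_iff] at hle
    exact (isSimpleModule_iff_isAtom.1 hA).1 hle
  rw [← sSup_simples_eq_top_iff_isSemisimpleModule]
  by_contra hne
  obtain ⟨K, hK, hle⟩ := (eq_top_or_exists_le_coatom _).resolve_left hne
  have : IsSimpleModule P ((P ⧸ Ring.jacobson P) ⧸ K) := isSimpleModule_iff_isCoatom.2 hK
  obtain ⟨g, hg⟩ := IsSimpleDirectInjective.exists_hom_ne_zero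
    (fun A _ hA _ _ ↦ hcomp A hA) h (f := K.mkQ) (fun h0 ↦ hK.1 (by rw [← K.ker_mkQ, h0]; simp))
  -- `g` embeds the simple quotient as a summand of `P ⧸ J(P)`; through the retraction `p`, lifting
  -- `p 1` along `mkQ` yields the section `ψ ∘ₗ g` of `mkQ`, whose range is simple but not in `K`.
  have hgr := isSimpleModule_range hg
  obtain ⟨p', hp'⟩ := Submodule.exists_projection_of_isComplemented (hcomp _ hgr)
  let e := LinearEquiv.ofInjective g (LinearMap.injective_of_ne_zero hg)
  let p := e.symm.toLinearMap ∘ₗ p'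
  have hp : ∀ q, p (g q) = q := fun q ↦ e.symm_apply_eq.2 (hp' (e q))
  obtain ⟨m, hm⟩ := K.mkQ_surjective (p (Submodule.Quotient.mk 1))
  let ψ := jacobsonQuotientToModule m fun j hj ↦ jacobson_smul_eq_zero_quotient hj m
  have hψ : ∀ x, K.mkQ (ψ x) = p x := by
    intro x
    obtain ⟨r, rfl⟩ := Submodule.Quotient.mk_surjective _ x
    rw [jacobsonQuotientToModule_mk, map_smul, hm, ← map_smul, ← Submodule.Quotient.mk_smul,
      smul_eq_mul, mul_one]
  have := IsSimpleModule.nontrivial P ((P ⧸ Ring.jacobson P) ⧸ K)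
  obtain ⟨q, hq⟩ := exists_ne (0 : (P ⧸ Ring.jacobson P) ⧸ K)
  have hψg : ψ ∘ₗ g ≠ 0 := fun h0 ↦ hq <| by
    rw [← hp q, ← hψ, ← LinearMap.comp_apply ψ, h0]; simp
  have hr : LinearMap.range (ψ ∘ₗ g) ≤ K := 
    (le_sSup (Set.mem_ofPred (p := fun T : Submodule P _ ↦ IsSimpleModule P T) |>.2
      (isSimpleModule_range hψg))).trans hle
  have hmem : ψ (g q) ∈ K := hr ⟨q, rfl⟩
  apply hq
  rw [← hp q, ← hψ]
  simpa using hmem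

/-- If `f ≠ 0`, the preimage `X` of `S₂` under `f` has `S₁` as its unique simple submodule, so it is
simple-direct-injective, and its quotient `S₂` would embed in it. -/
theorem hom_injectiveHull_eq_zero {S₁ S₂ E₁ E₂ : Type u} [AddCommGroup S₁] [AddCommGroup S₂]
    [AddCommGroup E₁] [AddCommGroup E₂] [Module P S₁] [Module P S₂] [Module P E₁] [Module P E₂]
    {i₁ : S₁ →ₗ[P] E₁} {i₂ : S₂ →ₗ[P] E₂} [IsSimpleModule P S₁] [IsSimpleModule P S₂]
    (hS : ¬ Nonempty (S₁ ≃ₗ[P] S₂)) (h₁ : IsInjectiveHull i₁) (h₂ : IsInjectiveHull i₂)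
    (f : E₁ →ₗ[P] E₂) : f = 0 := by
  by_contra hf
  let e₁ := LinearEquiv.ofInjective i₁ h₁.injective
  let e₂ := LinearEquiv.ofInjective i₂ h₂.injective
  have hr₁ : IsAtom (LinearMap.range i₁) := isSimpleModule_iff_isAtom.1 (.congr e₁.symm)
  let X := (LinearMap.range i₂).comap f
  have huniq : ∀ T : Submodule P X, IsSimpleModule P T → T.map X.subtype = LinearMap.range i₁ := by
    intro T hT
    have hT' : IsAtom (T.map X.subtype) := isSimpleModule_iff_isAtom.1
      (.congr (T.equivMapOfInjective _ X.subtype_injective).symm)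
    by_contra hne
    exact hT'.1 (h₁.essential _ (hr₁.disjoint_of_ne hT' (Ne.symm hne)).eq_bot)
  have hX : IsSimpleDirectInjective P X := by
    rintro A B hA ⟨e⟩ hB
    rwa [Submodule.map_injective_of_injective X.subtype_injective
      ((huniq A hA).trans (huniq B (.congr e.symm)).symm)]
  let F : X →ₗ[P] S₂ := e₂.symm.toLinearMap ∘ₗ f.restrict (p := X) fun _ hx ↦ hx
  have hF : F ≠ 0 := by
    intro hF
    refine hf (LinearMap.range_eq_bot.1 (h₂.essential _ ?_))
    rw [eq_bot_iff]
    rintro _ ⟨hy, x, rfl⟩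
    have := LinearMap.congr_fun hF ⟨x, hy⟩
    simpa [F, Subtype.ext_iff] using this
  obtain ⟨g, hg⟩ := hX.exists_hom_ne_zero h hF
  have hgr := isSimpleModule_range hg
  let T := LinearMap.range g
  exact hS ⟨e₁ ≪≫ₗ (LinearEquiv.ofEq _ _ (huniq T hgr)).symm ≪≫ₗ
    (T.equivMapOfInjective _ X.subtype_injective).symm ≪≫ₗ
    (LinearEquiv.ofInjective g (LinearMap.injective_of_ne_zero hg)).symm⟩

end SimpleDirect

/-! ### The Jacobson radical of the opposite ring -/

section Opposite

theorem isUnit_one_sub_of_mem_jacobson {A : Type u} [Ring A] {x : A} (hx : x ∈ Ring.jacobson A) :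
    IsUnit (1 - x) := by
  have left : ∀ y ∈ Ring.jacobson A, ∃ z, z * (1 - y) = 1 := by
    intro y hy
    by_contra! hz
    have hne : Ideal.span {1 - y} ≠ ⊤ := fun h ↦ by
      obtain ⟨z, hz'⟩ := Ideal.mem_span_singleton'.1 ((Ideal.eq_top_iff_one _).1 h)
      exact hz z hz'
    obtain ⟨m, hm, hle⟩ := Ideal.exists_le_maximal _ hne
    refine hm.ne_top ((Ideal.eq_top_iff_one _).2 ?_)
    simpa using m.add_mem (hle (Ideal.mem_span_singleton_self _))
      (Ring.jacobson_le_of_isMaximal m hy)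
  obtain ⟨z, hz⟩ := left x hx
  -- `z = 1 - (-(z x))` with `z x ∈ J(A)`, so `z` has a left inverse as well.
  obtain ⟨w, hw⟩ := left (-(z * x)) (neg_mem (Ideal.mul_mem_left _ z hx))
  have hz1 : 1 - -(z * x) = z := by rw [mul_sub, mul_one] at hz; rw [← hz]; abel
  rw [hz1] at hw
  have hwx : w = 1 - x := left_inv_eq_right_inv hw hz
  exact isUnit_iff_exists.2 ⟨z, hwx ▸ hw, hz⟩

/-- Left-right symmetry of the Jacobson radical. -/
theorem unop_mem_jacobson_of_mem {A B : Type u} [Ring A] [Ring B] (e : A ≃+* Bᵐᵒᵖ) {x : A}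
    (hx : x ∈ Ring.jacobson A) : unop (e x) ∈ Ring.jacobson B := by
  rw [Ring.jacobson_eq_sInf_isMaximal, Ideal.mem_sInf]
  intro m (hm : m.IsMaximal)
  by_contra hxm
  obtain ⟨b, hb⟩ := hm.exists_inv hxm
  obtain ⟨i, hi, hbi⟩ := hb
  have hu : IsUnit (1 - x * e.symm (op b)) :=
    isUnit_one_sub_of_mem_jacobson (Ideal.mul_mem_right _ _ hx)
  have hu' : IsUnit (unop (e (1 - x * e.symm (op b)))) := (hu.map e).unop
  refine hm.ne_top (Ideal.eq_top_of_isUnit_mem _ ?_ hu')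
  simpa [← hbi] using hi

theorem isSemisimpleRing_quotient_jacobson_of_op {A B : Type u} [Ring A] [Ring B]
    (e : A ≃+* Bᵐᵒᵖ) [IsSemisimpleRing (A ⧸ Ring.jacobson A)] :
    IsSemisimpleRing (B ⧸ Ring.jacobson B) := by
  rw [← isSemisimpleRing_mulOpposite_iff]
  let f : A →+* (B ⧸ Ring.jacobson B)ᵐᵒᵖ :=
    (RingHom.op (Ideal.Quotient.mk (Ring.jacobson B))).comp e.toRingHom
  have hf : ∀ x ∈ Ring.jacobson A, f x = 0 := fun x hx ↦
    unop_injective (Ideal.Quotient.eq_zero_iff_mem.2 (unop_mem_jacobson_of_mem e hx))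
  refine (Ideal.Quotient.lift _ f hf).isSemisimpleRing_of_surjective
    (Ideal.Quotient.lift_surjective_of_surjective _ _ ?_)
  intro y
  obtain ⟨b, hb⟩ := Ideal.Quotient.mk_surjective (unop y)
  exact ⟨e.symm (op b), unop_injective (by simp [f, hb])⟩

theorem isSemisimpleRing_of_isSemisimpleModule_quotient {A : Type u} [Ring A] (I : Ideal A)
    [I.IsTwoSided] (h : IsSemisimpleModule A (A ⧸ I)) : IsSemisimpleRing (A ⧸ I) := by
  let f : A ⧸ I →ₛₗ[Ideal.Quotient.mk I] A ⧸ I := ⟨AddHom.id _, fun _ _ ↦ rfl⟩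
  have : RingHomSurjective (Ideal.Quotient.mk I) := ⟨Ideal.Quotient.mk_surjective⟩
  exact (f.isSemisimpleModule_iff_of_bijective Function.bijective_id).1 h

theorem isSemisimpleModule_quotient_of_isSemisimpleRing {A : Type u} [Ring A] (I : Ideal A)
    [I.IsTwoSided] (h : IsSemisimpleRing (A ⧸ I)) : IsSemisimpleModule A (A ⧸ I) := by
  let f : A ⧸ I →ₛₗ[Ideal.Quotient.mk I] A ⧸ I := ⟨AddHom.id _, fun _ _ ↦ rfl⟩
  have : RingHomSurjective (Ideal.Quotient.mk I) := ⟨Ideal.Quotient.mk_surjective⟩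
  exact (f.isSemisimpleModule_iff_of_bijective Function.bijective_id).2 h

end Opposite

/-! ### T-nilpotence and simple submodules -/

section TNilpotent

/-- If every nonzero right module has a simple submodule, the right ideal `N` of all elements that
every sequence in `J(R)` eventually annihilates is everything: a simple submodule of `R / N` is killed
by `J(R)`, and shifting sequences shows that its representatives already lie in `N`. -/
theorem isLeftTNilpotent_jacobson_of_exists_simple {R : Type u} [Ring R]
    (h : ∀ (M : Type u) [AddCommGroup M] [Module Rᵐᵒᵖ M] [Nontrivial M],
      ∃ T : Submodule Rᵐᵒᵖ M, IsSimpleModule Rᵐᵒᵖ T) :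
    IsLeftTNilpotent (Ring.jacobson R : Set R) := by
  have mono : ∀ (a : ℕ → R) (x : R) (m n : ℕ), m ≤ n → x * ((List.range m).map a).prod = 0 →
      x * ((List.range n).map a).prod = 0 := by
    intro a x m n hmn hx
    obtain ⟨k, rfl⟩ := Nat.exists_eq_add_of_le hmn
    rw [List.range_add, List.map_append, List.prod_append, ← mul_assoc, hx, zero_mul]
  have shift : ∀ (a : ℕ → R) (n : ℕ), ((List.range (n + 1)).map a).prod =
      a 0 * ((List.range n).map fun k ↦ a (k + 1)).prod := by
    intro a n
    rw [List.range_succ_eq_map, List.map_cons, List.prod_cons, List.map_map]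
    rfl
  -- the right ideal of all `x` that every sequence in `J(R)` eventually annihilates
  let N : Submodule Rᵐᵒᵖ R :=
    { carrier := {x | ∀ a : ℕ → R, (∀ k, a k ∈ Ring.jacobson R) →
        ∃ n, x * ((List.range n).map a).prod = 0}
      zero_mem' := fun a _ ↦ ⟨0, zero_mul _⟩
      add_mem' := fun {x y} hx hy a ha ↦ by
        obtain ⟨m, hm⟩ := hx a ha
        obtain ⟨n, hn⟩ := hy a ha
        refine ⟨max m n, ?_⟩
        rw [add_mul, mono a x m _ (le_max_left _ _) hm, mono a y n _ (le_max_right _ _) hn,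
          add_zero]
      smul_mem' := fun r x hx a ha ↦ by
        -- the factor `r` is absorbed into the leading term of the sequence
        obtain ⟨n, hn⟩ := hx (fun k ↦ if k = 0 then unop r * a 0 else a k) fun k ↦ by
          by_cases hk : k = 0
          · simpa [hk] using Ideal.mul_mem_left _ (unop r) (ha 0)
          · simpa [hk] using ha k
        refine ⟨n + 1, ?_⟩
        have h1 := mono _ x n (n + 1) n.le_succ hn
        rw [shift] at h1
        rw [shift]
        simpa [mul_assoc] using h1 }
  have hN : N = ⊤ := by
    by_contra hne
    have : Nontrivial (R ⧸ N) := Submodule.Quotient.nontrivial_iff.2 hne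
    obtain ⟨T, hT⟩ := h (R ⧸ N)
    have := IsSimpleModule.nontrivial Rᵐᵒᵖ T
    obtain ⟨⟨t, ht⟩, ht0⟩ := exists_ne (0 : T)
    obtain ⟨x, rfl⟩ := Submodule.Quotient.mk_surjective _ t
    refine ht0 (Subtype.ext ((Submodule.Quotient.mk_eq_zero _).2 ?_))
    intro a ha
    have hj : op (a 0) ∈ Ring.jacobson Rᵐᵒᵖ :=
      unop_mem_jacobson_of_mem (RingEquiv.opOp R) (ha 0)
    have hxa : x * a 0 ∈ N := by
      have h0 := congrArg Subtype.val
        (jacobson_smul_eq_zero_of_isSimpleModule hj (⟨_, ht⟩ : T))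
      exact (Submodule.Quotient.mk_eq_zero N).1 h0
    obtain ⟨n, hn⟩ := hxa (fun k ↦ a (k + 1)) fun k ↦ ha (k + 1)
    exact ⟨n + 1, by rw [shift, ← mul_assoc, hn]⟩
  intro a ha
  obtain ⟨n, hn⟩ := (hN ▸ Submodule.mem_top : (1 : R) ∈ N) a ha
  exact ⟨n, by rwa [one_mul] at hn⟩

theorem exists_smul_ne_zero_jacobson_smul_eq_zero {R : Type u} [Ring R]
    (hT : IsLeftTNilpotent (Ring.jacobson R : Set R)) {M : Type v} [AddCommGroup M]
    [Module Rᵐᵒᵖ M] {x : M} (hx : x ≠ 0) :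
    ∃ r : Rᵐᵒᵖ, r • x ≠ 0 ∧ ∀ j ∈ Ring.jacobson Rᵐᵒᵖ, j • r • x = 0 := by
  by_contra! hc
  choose! j hj hjx using hc
  -- `r k` is the product of the first `k` terms of a sequence in `J(R)`
  let r : ℕ → Rᵐᵒᵖ := fun n ↦ Nat.rec 1 (fun _ s ↦ j s * s) n
  have hr : ∀ n, r n • x ≠ 0 := by
    intro n
    induction n with
    | zero => simpa [r] using hx
    | succ n ih => simpa [r, mul_smul] using hjx _ ih
  obtain ⟨n, hn⟩ := hT (fun k ↦ unop (j (r k))) fun k ↦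
    unop_mem_jacobson_of_mem (RingEquiv.refl _) (hj _ (hr k))
  have hprod : ∀ n, ((List.range n).map fun k ↦ unop (j (r k))).prod = unop (r n) := by
    intro n
    induction n with
    | zero => rfl
    | succ n ih => rw [List.range_succ, List.map_append, List.prod_append, ih]; simp [r]
  refine hr n ?_
  rw [hprod] at hn
  rw [unop_injective (hn.trans unop_zero.symm), zero_smul]

theorem exists_simple_submodule_le_span_singleton {R : Type u} [Ring R]
    (hT : IsLeftTNilpotent (Ring.jacobson R : Set R))
    [IsSemisimpleModule Rᵐᵒᵖ (Rᵐᵒᵖ ⧸ Ring.jacobson Rᵐᵒᵖ)] {M : Type v} [AddCommGroup M]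
    [Module Rᵐᵒᵖ M] {x : M} (hx : x ≠ 0) :
    ∃ T : Submodule Rᵐᵒᵖ M, IsSimpleModule Rᵐᵒᵖ T ∧ T ≤ Submodule.span Rᵐᵒᵖ {x} := by
  obtain ⟨r, hr, hj⟩ := exists_smul_ne_zero_jacobson_smul_eq_zero hT hx
  let φ := jacobsonQuotientToModule (r • x) hj
  have hss : IsSemisimpleModule Rᵐᵒᵖ (LinearMap.range φ) := .range φ
  have hmem : r • x ∈ LinearMap.range φ := ⟨Submodule.Quotient.mk 1, one_smul _ _⟩
  obtain ⟨T, hTle, hTs⟩ := (IsSemisimpleModule.eq_bot_or_exists_simple_le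
    (LinearMap.range φ)).resolve_left fun h ↦ hr (by simpa [h] using hmem)
  refine ⟨T, hTs, hTle.trans ?_⟩
  rintro _ ⟨y, rfl⟩
  obtain ⟨s, rfl⟩ := Submodule.Quotient.mk_surjective _ y
  rw [jacobsonQuotientToModule_mk, smul_smul]
  exact Submodule.smul_mem _ _ (Submodule.mem_span_singleton_self x)

theorem isNilpotent_of_mem_jacobson_op {R : Type u} [Ring R]
    (hT : IsLeftTNilpotent (Ring.jacobson R : Set R)) {j : Rᵐᵒᵖ} (hj : j ∈ Ring.jacobson Rᵐᵒᵖ) :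
    IsNilpotent j := by
  obtain ⟨n, hn⟩ := hT (fun _ ↦ unop j) fun _ ↦
    unop_mem_jacobson_of_mem (RingEquiv.refl _) hj
  exact ⟨n, unop_injective (by simpa using hn)⟩

end TNilpotent

/-! ### Existence of injective hulls -/

section Hull

variable {P : Type u} [Ring P]

theorem Module.Injective.of_retract {E L : Type v} [AddCommGroup E] [Module P E] [AddCommGroup L]
    [Module P L] (hE : Module.Injective P E) (i : L →ₗ[P] E) (p : E →ₗ[P] L)
    (hp : ∀ x, p (i x) = x) : Module.Injective P L where
  out X Y _ _ _ _ f hf g := by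
    obtain ⟨h, hh⟩ := hE.out f hf (i ∘ₗ g)
    exact ⟨p ∘ₗ h, fun x ↦ by rw [LinearMap.comp_apply, hh, LinearMap.comp_apply, hp]⟩

theorem exists_injective_module_embedding (M : Type u) [AddCommGroup M] [Module P M] :
    ∃ (E : Type u) (_ : AddCommGroup E) (_ : Module P E) (i : M →ₗ[P] E),
      Module.Injective P E ∧ Function.Injective i := by
  obtain ⟨pres⟩ := CategoryTheory.EnoughInjectives.presentation (ModuleCat.of P M)
  have := pres.injective
  have := pres.mono
  exact ⟨pres.J, inferInstance, inferInstance, pres.f.hom,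
    Module.injective_module_of_injective_object P pres.J,
    (ModuleCat.mono_iff_injective pres.f).1 this⟩

theorem Submodule.exists_maximal_disjoint {M : Type v} [AddCommGroup M] [Module P M]
    (L : Submodule P M) : ∃ K, Maximal (fun K : Submodule P M ↦ K ⊓ L = ⊥) K := by
  obtain ⟨K, -, hK⟩ := zorn_le_nonempty₀ {K : Submodule P M | K ⊓ L = ⊥}
    (fun c hc hchain y hy ↦ ⟨sSup c, eq_bot_iff.2 fun x ⟨hx, hxL⟩ ↦ by
      obtain ⟨K, hK, hxK⟩ := (Submodule.mem_sSup_of_directed ⟨y, hy⟩ hchain.directedOn).1 hx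
      exact (hc hK).le ⟨hxK, hxL⟩, fun z hz ↦ le_sSup hz⟩) ⊥ (bot_inf_eq L)
  exact ⟨K, hK⟩

/-- The hull is a maximal essential extension `L` of `M` inside an injective module `E`. With `K`
maximal among the submodules disjoint from `L`, the inclusion of `L` extends to a map `E / K → E`,
whose range is an essential extension of `M` too, so that it equals `L` and `L` is a retract of `E`. -/
theorem exists_isInjectiveHull (M : Type u) [AddCommGroup M] [Module P M] :
    ∃ (E : Type u) (_ : AddCommGroup E) (_ : Module P E) (i : M →ₗ[P] E), IsInjectiveHull i := by
  obtain ⟨E, _, _, i, hE, hi⟩ := exists_injective_module_embedding (P := P) M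
  -- `L` is an essential extension of the image of `M`
  let Ess : Submodule P E → Prop := fun L ↦
    LinearMap.range i ≤ L ∧ ∀ L' ≤ L, LinearMap.range i ⊓ L' = ⊥ → L' = ⊥
  obtain ⟨L, -, hL⟩ := zorn_le_nonempty₀ {L | Ess L}
    (fun c hc hchain y hy ↦ ⟨sSup c, ⟨(hc hy).1.trans (le_sSup hy), fun L' hL' h ↦ by
      rw [eq_bot_iff]
      intro x hx
      obtain ⟨K, hK, hxK⟩ := (Submodule.mem_sSup_of_directed ⟨y, hy⟩ hchain.directedOn).1 (hL' hx)
      have := (hc hK).2 (K ⊓ L') inf_le_left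
        (eq_bot_iff.2 ((inf_le_inf_left _ inf_le_right).trans h.le))
      rw [← this]
      exact ⟨hxK, hx⟩⟩, fun z hz ↦ le_sSup hz⟩) (LinearMap.range i)
    ⟨le_rfl, fun L' hL' h ↦ by rwa [inf_eq_right.2 hL'] at h⟩
  obtain ⟨K, hK⟩ := L.exists_maximal_disjoint
  have hinj : Function.Injective (K.mkQ ∘ₗ L.subtype) := by
    rw [← LinearMap.ker_eq_bot, eq_bot_iff]
    intro x hx
    have hxK : (x : E) ∈ K := by simpa using hx
    have : (x : E) ∈ K ⊓ L := ⟨hxK, x.2⟩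
    rw [hK.prop] at this
    simpa using this
  -- maximality of `K` makes the image of `L` essential in `E ⧸ K`
  have hess : ∀ Q : Submodule P (E ⧸ K), (∀ l ∈ L, K.mkQ l ∈ Q → l = 0) → Q = ⊥ := by
    intro Q hQ
    have hle : K ≤ Q.comap K.mkQ := fun x hx ↦ by
      rw [Submodule.mem_comap, Submodule.mkQ_apply, (Submodule.Quotient.mk_eq_zero K).2 hx]
      exact Q.zero_mem
    have hdis : Q.comap K.mkQ ⊓ L = ⊥ := by
      rw [eq_bot_iff]
      rintro x ⟨hx, hxL⟩
      exact hQ x hxL hx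
    have heq : Q.comap K.mkQ ≤ K := hK.le_of_ge hdis hle
    rw [eq_bot_iff]
    intro q hq
    obtain ⟨x, rfl⟩ := K.mkQ_surjective q
    exact (Submodule.Quotient.mk_eq_zero K).2 (heq hq)
  obtain ⟨h, hh⟩ := hE.out (K.mkQ ∘ₗ L.subtype) hinj L.subtype
  have hh' : ∀ l ∈ L, h (K.mkQ l) = l := fun l hl ↦ hh ⟨l, hl⟩
  have hLr : L ≤ LinearMap.range h := fun l hl ↦ ⟨_, hh' l hl⟩
  have hEss : Ess (LinearMap.range h) := by
    refine ⟨hL.prop.1.trans hLr, fun L' hL' hd ↦ ?_⟩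
    have h0 : L ⊓ L' = ⊥ := hL.prop.2 _ inf_le_left
      (eq_bot_iff.2 ((inf_le_inf_left _ inf_le_right).trans hd.le))
    have h1 : L'.comap h = ⊥ := hess _ fun l hl hl' ↦ by
      rw [Submodule.mem_comap, hh' l hl] at hl'
      have : l ∈ L ⊓ L' := ⟨hl, hl'⟩
      rwa [h0] at this
    rw [eq_bot_iff]
    intro y hy
    obtain ⟨q, rfl⟩ := hL' hy
    have : q ∈ L'.comap h := hy
    rw [h1, Submodule.mem_bot] at this
    rw [this, map_zero]
    exact zero_mem _
  have hrL : LinearMap.range h ≤ L := hL.le_of_ge hEss hLr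
  let p : E →ₗ[P] L := (h ∘ₗ K.mkQ).codRestrict L fun x ↦ hrL ⟨_, rfl⟩
  refine ⟨L, inferInstance, inferInstance, i.codRestrict L fun x ↦ hL.prop.1 ⟨x, rfl⟩,
    hE.of_retract L.subtype p fun x ↦ Subtype.ext (hh' x x.2),
    fun x y hxy ↦ hi (congrArg Subtype.val hxy), fun L' hL' ↦ ?_⟩
  have : L'.map L.subtype = ⊥ := hL.prop.2 _ (L.map_subtype_le L') (by
    rw [eq_bot_iff]
    rintro _ ⟨⟨x, rfl⟩, y, hy, hyx⟩
    have hmem : y ∈ LinearMap.range (i.codRestrict L fun x ↦ hL.prop.1 ⟨x, rfl⟩) ⊓ L' :=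
      ⟨⟨x, Subtype.ext hyx.symm⟩, hy⟩
    rw [hL', Submodule.mem_bot] at hmem
    rw [← hyx, hmem]
    exact zero_mem _)
  exact Submodule.map_injective_of_injective L.subtype_injective
    (this.trans (Submodule.map_bot _).symm)

theorem IsInjectiveHull.exists_extension {S E X Y : Type u} [AddCommGroup S] [Module P S]
    [AddCommGroup E] [Module P E] {i : S →ₗ[P] E} (hi : IsInjectiveHull i) [AddCommGroup X]
    [Module P X] [AddCommGroup Y] [Module P Y] {f : X →ₗ[P] Y} (hf : Function.Injective f)
    (g : X →ₗ[P] S) : ∃ h : Y →ₗ[P] E, ∀ x, h (f x) = i (g x) :=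
  hi.injective_module.out f hf (i ∘ₗ g)

end Hull

/-! ### The idempotent attached to a simple module -/

section Idempotent

variable {P : Type u} [Ring P]

/-- For a simple module `B = P b` there is an idempotent `e` with `e b = b` such that `P e / J e ≅ B`.
The isomorphism is expressed by a mapping property: an element `y = e y` annihilated by `J(P)` is the
image of `b` under a homomorphism from `B`. -/
theorem exists_isIdempotentElem_smul_eq [IsSemisimpleModule P (P ⧸ Ring.jacobson P)]
    (hnil : ∀ j ∈ Ring.jacobson P, IsNilpotent j) {B : Type u} [AddCommGroup B] [Module P B]
    [IsSimpleModule P B] {b : B} (hb : b ≠ 0) :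
    ∃ e : P, IsIdempotentElem e ∧ e • b = b ∧ ∀ (M : Type u) [AddCommGroup M] [Module P M] (y : M),
      (∀ j ∈ Ring.jacobson P, j • y = 0) → e • y = y → ∃ g : B →ₗ[P] M, g b = y := by
  have hJb : ∀ j ∈ Ring.jacobson P, j • b = 0 := fun j hj ↦
    jacobson_smul_eq_zero_of_isSimpleModule hj b
  let π := jacobsonQuotientToModule b hJb
  have hπ : π ≠ 0 := fun h ↦ hb <| by
    rw [← one_smul P b]
    exact LinearMap.congr_fun h (Submodule.Quotient.mk 1)
  obtain ⟨s, hs⟩ := IsSemisimpleModule.lifting_property π (LinearMap.surjective_of_ne_zero hπ)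
    LinearMap.id
  obtain ⟨e₀, he₀⟩ := Submodule.Quotient.mk_surjective _ (s b)
  have he₀b : e₀ • b = b := by
    rw [← jacobsonQuotientToModule_mk b hJb, he₀]
    exact LinearMap.congr_fun hs b
  have hidem : IsIdempotentElem (Ideal.Quotient.mk (Ring.jacobson P) e₀) := by
    change Submodule.Quotient.mk (e₀ • e₀) = Submodule.Quotient.mk e₀
    rw [Submodule.Quotient.mk_smul, he₀, ← map_smul, he₀b]
  obtain ⟨e, he, hee₀⟩ := exists_isIdempotentElem_eq_of_ker_isNilpotent
    (Ideal.Quotient.mk (Ring.jacobson P)) (fun x hx ↦ hnil x (by rwa [Ideal.mk_ker] at hx)) _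
    ⟨e₀, rfl⟩ hidem
  have hes : (Submodule.Quotient.mk e : P ⧸ Ring.jacobson P) = s b := Eq.trans hee₀ he₀
  refine ⟨e, he, ?_, fun M _ _ y hy hey ↦ ⟨jacobsonQuotientToModule y hy ∘ₗ s, ?_⟩⟩
  · rw [← jacobsonQuotientToModule_mk b hJb, hes]
    exact LinearMap.congr_fun hs b
  · rw [LinearMap.comp_apply, ← hes, jacobsonQuotientToModule_mk, hey]

/-- Let `e` be an idempotent with the mapping property of `exists_isIdempotentElem_smul_eq`. If
`e x ≠ 0`, then a simple quotient of `P e x` is isomorphic to `B`, and the map `P e x → B → F` extends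
to a nonzero map `E → F`. -/
theorem smul_injectiveHull_eq_zero {e : P} {B : Type u} [AddCommGroup B] [Module P B]
    [IsSimpleModule P B] {b : B} (he : IsIdempotentElem e)
    (hlift : ∀ (M : Type u) [AddCommGroup M] [Module P M] (y : M),
      (∀ j ∈ Ring.jacobson P, j • y = 0) → e • y = y → ∃ g : B →ₗ[P] M, g b = y)
    {E F : Type u} [AddCommGroup E] [Module P E] [AddCommGroup F] [Module P F]
    {iB : B →ₗ[P] F} (hF : IsInjectiveHull iB) (hzero : ∀ f : E →ₗ[P] F, f = 0) (x : E) :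
    e • x = 0 := by
  by_contra hx
  let N := Submodule.span P {e • x}
  let y : N := ⟨e • x, Submodule.mem_span_singleton_self _⟩
  have hey : e • y = y := Subtype.ext (by simp [y, smul_smul, he.eq])
  have : Nontrivial N := ⟨y, 0, fun h ↦ hx (congrArg Subtype.val h)⟩
  have : Module.Finite P N := Module.Finite.span_singleton P _
  obtain ⟨K, hK, -⟩ := (eq_top_or_exists_le_coatom (⊥ : Submodule P N)).resolve_left bot_ne_top
  have : IsSimpleModule P (N ⧸ K) := isSimpleModule_iff_isCoatom.2 hK
  have hyK : K.mkQ y ≠ 0 := by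
    intro h
    refine hK.1 (eq_top_iff.2 ?_)
    rintro ⟨z, hz⟩ -
    obtain ⟨r, rfl⟩ := Submodule.mem_span_singleton.1 hz
    exact K.smul_mem r ((Submodule.Quotient.mk_eq_zero K).1 h)
  obtain ⟨g, hg⟩ := hlift (N ⧸ K) (K.mkQ y)
    (fun j hj ↦ jacobson_smul_eq_zero_of_isSimpleModule hj _) (by rw [← map_smul, hey])
  have hg0 : g ≠ 0 := fun h ↦ hyK (by rw [← hg, h, LinearMap.zero_apply])
  let eg := LinearEquiv.ofBijective g (LinearMap.bijective_of_ne_zero hg0)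
  obtain ⟨f, hf⟩ := hF.exists_extension N.subtype_injective (eg.symm.toLinearMap ∘ₗ K.mkQ)
  have h0 := hf y
  rw [hzero f, LinearMap.zero_apply] at h0
  have h1 := hF.injective (h0.symm.trans (map_zero iB).symm)
  exact hyK (eg.symm.map_eq_zero_iff.1 h1)

end Idempotent

/-! ### Left perfect right H-rings and the equivalence -/

theorem IsSimpleDirectInjective.isSimpleDirectProjective {R : Type u} [Ring R]
    (hR : IsLeftPerfectRing R) (hH : IsRightHRing R) {M : Type u} [AddCommGroup M] [Module Rᵐᵒᵖ M]
    (hM : IsSimpleDirectInjective Rᵐᵒᵖ M) : IsSimpleDirectProjective Rᵐᵒᵖ M := by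
  rintro A B hB ⟨eAB⟩ hBc
  have hss : IsSemisimpleModule Rᵐᵒᵖ (Rᵐᵒᵖ ⧸ Ring.jacobson Rᵐᵒᵖ) := by
    have := hR.isSemisimpleRing
    exact isSemisimpleModule_quotient_of_isSemisimpleRing _
      (isSemisimpleRing_quotient_jacobson_of_op (RingEquiv.opOp R))
  have hA : IsCoatom A := isSimpleModule_iff_isCoatom.1 (.congr eAB)
  suffices h : ∃ T : Submodule Rᵐᵒᵖ M, IsSimpleModule Rᵐᵒᵖ T ∧ ¬ T ≤ A by
    obtain ⟨T, hT, hTA⟩ := h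
    exact ⟨T, Submodule.isCompl_of_isCoatom_of_not_le hA hTA⟩
  have := IsSimpleModule.nontrivial Rᵐᵒᵖ B
  obtain ⟨b, hb⟩ := exists_ne (0 : B)
  obtain ⟨e, he, heb, hlift⟩ := exists_isIdempotentElem_smul_eq
    (fun j hj ↦ isNilpotent_of_mem_jacobson_op hR.isLeftTNilpotent hj) hb
  obtain ⟨x, hx⟩ := A.mkQ_surjective (eAB.symm b)
  have hyA : e • x ∉ A := by
    intro h
    have h0 : A.mkQ (e • x) = 0 := (Submodule.Quotient.mk_eq_zero A).2 h
    rw [map_smul, hx, ← map_smul, heb] at h0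
    exact hb (eAB.symm.map_eq_zero_iff.1 h0)
  have hey : e • e • x = e • x := by rw [smul_smul, he.eq]
  by_cases hJ : ∀ j ∈ Ring.jacobson Rᵐᵒᵖ, j • e • x = 0
  · obtain ⟨g, hg⟩ := hlift M (e • x) hJ hey
    have hg0 : g ≠ 0 := fun h ↦ hyA (by rw [← hg, h]; exact zero_mem _)
    exact ⟨LinearMap.range g, isSimpleModule_range hg0, fun h ↦ hyA (h ⟨b, hg⟩)⟩
  · push Not at hJ
    obtain ⟨j, hj, hjx⟩ := hJ
    obtain ⟨T, hT, hTle⟩ := exists_simple_submodule_le_span_singleton hR.isLeftTNilpotent hjx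
    have := IsSimpleModule.nontrivial Rᵐᵒᵖ T
    obtain ⟨t, ht⟩ := exists_ne (0 : T)
    obtain ⟨r, hr⟩ := Submodule.mem_span_singleton.1 (hTle t.2)
    exfalso
    by_cases hTB : Nonempty (T ≃ₗ[Rᵐᵒᵖ] B)
    -- `T ≅ B` is a direct summand, which is impossible inside `J(R)M`
    · obtain ⟨p, hp⟩ := Submodule.exists_projection_of_isComplemented (hM T B hT hTB hBc)
      refine ht ?_
      rw [← hp t, ← hr, map_smul, map_smul,
        jacobson_smul_eq_zero_of_isSimpleModule hj (p _), smul_zero]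
    -- otherwise `T` embeds in an injective hull on which `e` vanishes
    · obtain ⟨E, _, _, iT, hiT⟩ := exists_isInjectiveHull (P := Rᵐᵒᵖ) T
      obtain ⟨F, _, _, iB, hiB⟩ := exists_isInjectiveHull (P := Rᵐᵒᵖ) B
      obtain ⟨φ, hφ⟩ := hiT.exists_extension T.subtype_injective LinearMap.id
      have h0 : φ (e • x) = 0 := by
        rw [map_smul]
        exact smul_injectiveHull_eq_zero he hlift hiB (hH T B E F iT iB hT hB hTB hiT hiB) _
      refine ht (hiT.injective ?_)
      rw [map_zero, ← LinearMap.id_apply (R := Rᵐᵒᵖ) t, ← hφ t, Submodule.subtype_apply, ← hr,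
        map_smul, map_smul, h0, smul_zero, smul_zero]

theorem theorem4p2 (R : Type u) [Ring R] :
    (IsLeftPerfectRing R ∧ IsRightHRing R) ↔
      ∀ (M : Type u) [AddCommGroup M] [Module Rᵐᵒᵖ M],
        IsSimpleDirectInjective Rᵐᵒᵖ M → IsSimpleDirectProjective Rᵐᵒᵖ M := by
  refine ⟨fun ⟨hR, hH⟩ M _ _ hM ↦ hM.isSimpleDirectProjective hR hH, fun h ↦ ⟨⟨?_, ?_⟩, ?_⟩⟩
  · have := isSemisimpleRing_of_isSemisimpleModule_quotient _
      (isSemisimpleModule_quotient_jacobson h)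
    exact isSemisimpleRing_quotient_jacobson_of_op (RingEquiv.refl Rᵐᵒᵖ)
  · exact isLeftTNilpotent_jacobson_of_exists_simple fun M _ _ _ ↦
      exists_simple_submodule_of_nontrivial h M
  · intro S₁ S₂ E₁ E₂ _ _ _ _ _ _ _ _ i₁ i₂ _ _ hS h₁ h₂ f
    exact hom_injectiveHull_eq_zero h hS h₁ h₂ f
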